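/- Let $n\ge 1$ and $d\ge 1$ be integers, put $\bar n=n-1$, $x=(x_1,\dots,x_n)$, $\bar x=(x_1,\dots,x_{n-1})$, $d_0=\lceil d/2\rceil$, and let $e$ denote the vector of all ones. For $m,t\in\mathbb{N}$ let $\mathbb{N}^m_t=\{\alpha\in\mathbb{N}^m:|\alpha|\le t\}$ and $\overline{\mathbb{N}}^m_t=\{\alpha\in\mathbb{N}^m:|\alpha|=t\}$. *Completely positive cones.* $\mathcal{CP}_{n,d}\subseteq\mathbb{R}^{\overline{\mathbb{N}}^n_d}$ is the set of finite sums $[u_1]_d^{hom}+\cdots+[u_r]_d^{hom}$ with $u_1,\dots,u_r\in\mathbb{R}^n_+$, where $[u]_d^{hom}=(u^\alpha)_{|\alpha|=d}$. $\mathcal{CP}_n^{\otimes d}$ is the set of symmetric tensors $\mathcal{A}\in\mathtt{S}^d(\mathbb{R}^n)$ of the form $v_1^{\otimes d}+\cdots+v_r^{\otimes d}$ with $v_1,\dots,v_r\in\mathbb{R}^n_+$. The linear map $\phi:\mathtt{S}^d(\mathbb{R}^n)\to\mathbb{R}^{\overline{\mathbb{N}}^n_d}$ is given by $\phi(\mathcal{A})_\alpha=\mathcal{A}_{i_1\dots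 i_d}$ whenever $x^\alpha=x_{i_1}\cdots x_{i_d}$. *Dehomogenization.* $\varpi:\mathbb{R}[x]_d^{hom}\to\mathbb{R}[\bar x]_d$, $\varpi(f)=f(\bar x,1-e^T\bar x)$, is a linear isomorphism from the forms of degree $d$ to the polynomials of degree at most $d$. Its inverse adjoint $\varpi^{-T}:\mathbb{R}^{\overline{\mathbb{N}}^n_d}\to\mathbb{R}^{\mathbb{N}^{\bar n}_d}$ is given by $(\varpi^{-T}(y))_\alpha=\langle\varpi^{-1}(\bar x^\alpha),y\rangle$, where $\langle f,y\rangle=\sum_{\alpha} f_\alpha y_\alpha$. *Moment relaxations.* For $z\in\mathbb{R}^{\mathbb{N}^{\bar n}_{2k}}$ and $q\in\mathbb{R}[\bar x]$, let $L_q^{(k)}[z]$ be the $k$th order localizing matrix: the symmetric matrix indexed by the exponents $\alpha$ with $\deg(q)+2|\alpha|\le 2k$, with $(\alpha,\beta)$ entry $\langle q\,\bar x^{\alpha+\beta},z\rangle=\sum_\gamma q_\gamma z_{\alpha+\beta+\gamma}$. Let $\mathscr{S}[\overline\Delta]_{2k}$ be the set of all $z\in\mathbb{R}^{\mathbb{N}^{\bar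 n}_{2k}}$ for which $L_1^{(k)}[z]$, $L_{1-e^T\bar x}^{(k)}[z]$, $L_{x_i}^{(k)}[z]$ ($1\le i\le n-1$) and $L_{1-\|\bar x\|^2}^{(k)}[z]$ are all positive semidefinite. For $k\ge d_0$, let $\mathscr{F}[\overline\Delta]_k\subseteq\mathbb{R}^{\mathbb{N}^{\bar n}_d}$ be the set of truncations $(z_\alpha)_{|\alpha|\le d}$ of the elements $z\in\mathscr{S}[\overline\Delta]_{2k}$, and let $$\mathcal{H}_k=\{y\in\mathbb{R}^{\overline{\mathbb{N}}^n_d}:\ \varpi^{-T}(y)\in\mathscr{F}[\overline\Delta]_k\}.$$ **Theorem.** The sets $\mathcal{H}_k$, $k\ge d_0$, form a nested family of outer approximations of $\mathcal{CP}_{n,d}$, that is, $\mathcal{H}_{d_0}\supseteq\mathcal{H}_{d_0+1}\supseteq\cdots\supseteq\mathcal{CP}_{n,d}$ (every $\mathcal H_k$ contains $\mathcal{CP}_{n,d}$), and $$\bigcap_{k\ge d_0}\mathcal{H}_k=\mathcal{CP}_{n,d},\qquad \bigcap_{k\ge d_0}\phi^{-1}(\mathcal{H}_k)=\mathcal{CP}_n^{\otimes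 d}.$$ -/

import Mathlib

noncomputable section

namespace CPMoment

open MvPolynomial

/-! ### Power sets and (homogeneous) truncated multi-sequences -/

/-- The power set `ℕ^n_d` of exponents `α` with `|α| ≤ d`. -/
abbrev Idx (n d : ℕ) : Type := {α : Fin n →₀ ℕ // α.degree ≤ d}

/-- The set of exponents `α ∈ ℕ^n` with `|α| = d`. -/
abbrev HIdx (n d : ℕ) : Type := {α : Fin n →₀ ℕ // α.degree = d}

instance (n d : ℕ) : Finite (Idx n d) := (Finsupp.finite_of_degree_le (σ := Fin n) d).to_subtype

instance (n d : ℕ) : Finite (HIdx n d) := (Finsupp.finite_of_degree_eq (σ := Fin n) d).to_subtype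

instance (n d : ℕ) : Fintype (Idx n d) := Fintype.ofFinite _

instance (n d : ℕ) : Fintype (HIdx n d) := Fintype.ofFinite _

/-- Truncated multi-sequences of degree `d` in `n` variables. -/
abbrev Tms (n d : ℕ) : Type := Idx n d → ℝ

/-- Homogeneous truncated multi-sequences of degree `d` in `n` variables. -/
abbrev Htms (n d : ℕ) : Type := HIdx n d → ℝ

/-- The vector `[u]_d^hom` of all monomials of degree exactly `d`, evaluated at `u`. -/
def hmono (n d : ℕ) (u : Fin n → ℝ) : Htms n d := fun α => ∏ i, u i ^ (α.1 i)

/-- The pairing `⟨p, z⟩ = ∑_{|α| ≤ d} p_α z_α`. -/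
def pair {n d : ℕ} (p : MvPolynomial (Fin n) ℝ) (z : Tms n d) : ℝ :=
  ∑ α : Idx n d, coeff α.1 p * z α

/-- The pairing `⟨f, y⟩ = ∑_{|α| = d} f_α y_α`. -/
def hpair {n d : ℕ} (f : MvPolynomial (Fin n) ℝ) (y : Htms n d) : ℝ :=
  ∑ α : HIdx n d, coeff α.1 f * y α

/-! ### Symmetric tensors, completely positive tensors and completely positive htms -/

/-- The space `S^d(ℝ^n)` of symmetric tensors of order `d` over `ℝ^n`. -/
def SymTensor (n d : ℕ) : Submodule ℝ ((Fin d → Fin n) → ℝ) where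
  carrier := {A | ∀ (σ : Equiv.Perm (Fin d)) (i : Fin d → Fin n), A (i ∘ σ) = A i}
  add_mem' := by
    intro A B hA hB σ i
    simp only [Pi.add_apply, hA σ i, hB σ i]
  zero_mem' := by
    intro σ i
    rfl
  smul_mem' := by
    intro c A hA σ i
    simp only [Pi.smul_apply, hA σ i]

/-- The rank-one symmetric tensor `v^{⊗ d}`. -/
def rankOne (n d : ℕ) (v : Fin n → ℝ) : SymTensor n d :=
  ⟨fun i => ∏ j, v (i j), fun σ i => Equiv.prod_comp σ (fun j => v (i j))⟩

/-- The cone `CP_n^{⊗ d}` of completely positive tensors. -/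
def CPTensor (n d : ℕ) : Set (SymTensor n d) :=
  {A | ∃ (r : ℕ) (v : Fin r → Fin n → ℝ), (∀ s i, 0 ≤ v s i) ∧ A = ∑ s, rankOne n d (v s)}

/-- The cone `CP_{n,d}` of completely positive htms. -/
def CPHtms (n d : ℕ) : Set (Htms n d) :=
  {y | ∃ (r : ℕ) (u : Fin r → Fin n → ℝ), (∀ s i, 0 ≤ u s i) ∧ y = ∑ s, hmono n d (u s)}

/-- The exponent `α` with `x^α = x_{i_1} ⋯ x_{i_d}`. -/
def expo {n d : ℕ} (i : Fin d → Fin n) : HIdx n d :=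
  ⟨∑ j, Finsupp.single (i j) 1, by simp [map_sum, Finsupp.degree_single]⟩

theorem expo_apply {n d : ℕ} (i : Fin d → Fin n) (a : Fin n) :
    (expo i).1 a = Fintype.card {j // i j = a} := by
  classical
  simp [expo, Finsupp.finsetSum_apply, Finsupp.single_apply, Fintype.card_subtype]

theorem expo_surjective (n d : ℕ) : Function.Surjective (expo : (Fin d → Fin n) → HIdx n d) := by
  classical
  rintro ⟨α, hα⟩
  have hc : Fintype.card (Fin d) = Fintype.card (Σ a : Fin n, Fin (α a)) := by
    simp [← hα, Finsupp.degree_eq_sum]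
  let e := Fintype.equivOfCardEq hc
  refine ⟨fun j => (e j).1, Subtype.ext (Finsupp.ext fun a => ?_)⟩
  rw [expo_apply]
  have e1 : {j // (e j).1 = a} ≃ {p : (Σ a : Fin n, Fin (α a)) // p.1 = a} :=
    e.subtypeEquiv (fun j => Iff.rfl)
  have e2 : {p : (Σ a : Fin n, Fin (α a)) // p.1 = a} ≃ Fin (α a) := Equiv.sigmaSubtype a
  rw [Fintype.card_congr (e1.trans e2), Fintype.card_fin]

/-- The linear map `φ : S^d(ℝ^n) → ℝ^{HIdx n d}` with `φ(A)_α = A_{i_1 … i_d}` whenever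
`x^α = x_{i_1} ⋯ x_{i_d}`; by symmetry of `A` the choice of the label does not matter,
see `phi_expo`. -/
def phi (n d : ℕ) : SymTensor n d →ₗ[ℝ] Htms n d where
  toFun A := fun α => A.1 (Function.surjInv (expo_surjective n d) α)
  map_add' := by
    intro A B
    rfl
  map_smul' := by
    intro c A
    rfl

theorem phi_expo {n d : ℕ} (A : SymTensor n d) (i : Fin d → Fin n) :
    phi n d A (expo i) = A.1 i := by
  classical
  set i' := Function.surjInv (expo_surjective n d) (expo i) with hi'
  have h : expo i' = expo i := Function.surjInv_eq (expo_surjective n d) (expo i)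
  have hcard : ∀ a, Fintype.card {j // i' j = a} = Fintype.card {j // i j = a} := by
    intro a
    rw [← expo_apply, ← expo_apply, h]
  let σ : Equiv.Perm (Fin d) :=
    Equiv.ofFiberEquiv (f := i') (g := i) (fun a => Fintype.equivOfCardEq (hcard a))
  have hσ : i ∘ σ = i' := by
    funext j
    exact Equiv.ofFiberEquiv_map _ j
  change A.1 i' = A.1 i
  rw [← hσ]
  exact A.2 σ i

theorem phi_rankOne (n d : ℕ) (u : Fin n → ℝ) : phi n d (rankOne n d u) = hmono n d u := by
  classical
  funext α
  obtain ⟨i, rfl⟩ := expo_surjective n d α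
  rw [phi_expo]
  change ∏ j, u (i j) = ∏ a, u a ^ ((expo i).1 a)
  simp only [expo_apply, Fintype.card_subtype]
  rw [← Finset.prod_fiberwise' Finset.univ i u]
  simp

/-! ### Dehomogenization. Below `n = m + 1`, so that `m = n - 1` is the number of variables of
`x̄ = (x_1, …, x_{n-1})`. -/

/-- The linear form `e^T x`. -/
def linForm (n : ℕ) : MvPolynomial (Fin n) ℝ := ∑ i, X i

/-- The substitution `f ↦ f(x̄, 1 - e^T x̄)`. -/
def dehomSubst (m : ℕ) : MvPolynomial (Fin (m + 1)) ℝ →ₐ[ℝ] MvPolynomial (Fin m) ℝ :=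
  aeval (Fin.snoc (α := fun _ => MvPolynomial (Fin m) ℝ) (fun i => X i) (1 - linForm m))

/-- The map `∑_α g_α x̄^α ↦ ∑_α g_α x̄^α (e^T x)^{d - |α|}`. -/
def homogenize (m d : ℕ) (g : MvPolynomial (Fin m) ℝ) : MvPolynomial (Fin (m + 1)) ℝ :=
  ∑ α : Idx m d, C (coeff α.1 g) *
    (rename Fin.castSucc (monomial α.1 1) * linForm (m + 1) ^ (d - α.1.degree))

theorem linForm_isHomogeneous (n : ℕ) : (linForm n).IsHomogeneous 1 :=
  IsHomogeneous.sum _ _ _ fun i _ => isHomogeneous_X ℝ i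

theorem dehomSubst_castSucc (m : ℕ) (i : Fin m) : dehomSubst m (X i.castSucc) = X i := by
  simp [dehomSubst]

theorem dehomSubst_last (m : ℕ) : dehomSubst m (X (Fin.last m)) = 1 - linForm m := by
  simp [dehomSubst]

theorem dehomSubst_linForm (m : ℕ) : dehomSubst m (linForm (m + 1)) = 1 := by
  rw [linForm, map_sum, Fin.sum_univ_castSucc]
  simp only [dehomSubst_castSucc, dehomSubst_last, linForm]
  ring

theorem dehomSubst_mem {m d : ℕ} {f : MvPolynomial (Fin (m + 1)) ℝ} (hf : f.IsHomogeneous d) :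
    dehomSubst m f ∈ restrictTotalDegree (Fin m) ℝ d := by
  have hlin : (1 - linForm m).totalDegree ≤ 1 :=
    (totalDegree_sub _ _).trans (max_le (by simp) (linForm_isHomogeneous m).totalDegree_le)
  rw [mem_restrictTotalDegree, dehomSubst, aeval_def, eval₂_eq']
  refine totalDegree_finsetSum_le fun s hs => ?_
  refine (totalDegree_mul _ _).trans ?_
  rw [algebraMap_eq, totalDegree_C, zero_add]
  refine (totalDegree_finsetProd _ _).trans ?_
  have hdeg : d = ∑ i, s i := by
    rw [← Finsupp.degree_eq_sum, Finsupp.degree_apply]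
    exact hf.degree_eq_sum_deg_support hs
  rw [hdeg]
  refine Finset.sum_le_sum fun i _ => (totalDegree_pow _ _).trans ?_
  refine (Nat.mul_le_mul_left (s i) (?_ : _ ≤ 1)).trans_eq (mul_one _)
  refine Fin.lastCases ?_ (fun j => ?_) i
  · simpa using hlin
  · simp

theorem homogenize_isHomogeneous (m d : ℕ) (g : MvPolynomial (Fin m) ℝ) :
    (homogenize m d g).IsHomogeneous d := by
  refine IsHomogeneous.sum _ _ _ fun α _ => IsHomogeneous.C_mul ?_ _
  have h := ((isHomogeneous_monomial (R := ℝ) 1 (rfl : α.1.degree = _)).rename_isHomogeneous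
    (f := (Fin.castSucc : Fin m → Fin (m + 1)))).mul
    ((linForm_isHomogeneous (m + 1)).pow (d - α.1.degree))
  have hα := α.2
  convert h using 1
  omega

theorem sum_idx_monomial {m d : ℕ} {g : MvPolynomial (Fin m) ℝ}
    (hg : g ∈ restrictTotalDegree (Fin m) ℝ d) :
    ∑ α : Idx m d, C (coeff α.1 g) * monomial α.1 (1 : ℝ) = g := by
  classical
  ext β
  rw [coeff_sum]
  simp only [coeff_C_mul, coeff_monomial]
  by_cases hβ : β.degree ≤ d
  · rw [Finset.sum_eq_single (⟨β, hβ⟩ : Idx m d)]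
    · simp
    · intro α _ hα
      rw [if_neg (fun h => hα (Subtype.ext h)), mul_zero]
    · intro h
      exact absurd (Finset.mem_univ _) h
  · rw [Finset.sum_eq_zero]
    · symm
      by_contra hne
      apply hβ
      rw [mem_restrictTotalDegree] at hg
      exact (le_totalDegree (mem_support_iff.mpr hne)).trans hg
    · intro α _
      have hne : α.1 ≠ β := by
        intro h
        exact hβ (h ▸ α.2)
      rw [if_neg hne, mul_zero]

theorem dehomSubst_homogenize {m d : ℕ} {g : MvPolynomial (Fin m) ℝ}
    (hg : g ∈ restrictTotalDegree (Fin m) ℝ d) : dehomSubst m (homogenize m d g) = g := by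
  have hren : ∀ p : MvPolynomial (Fin m) ℝ, dehomSubst m (rename Fin.castSucc p) = p := by
    intro p
    have : (dehomSubst m).comp (rename Fin.castSucc) = AlgHom.id ℝ _ := by
      ext i : 1
      simp [dehomSubst_castSucc]
    exact DFunLike.congr_fun this p
  conv_rhs => rw [← sum_idx_monomial hg]
  rw [homogenize, map_sum]
  refine Finset.sum_congr rfl fun α _ => ?_
  rw [map_mul, map_mul, map_pow, dehomSubst_linForm, one_pow, mul_one, hren]
  congr 1
  exact (dehomSubst m).commutes _

theorem eval_mul_of_isHomogeneous {n d : ℕ} {f : MvPolynomial (Fin n) ℝ}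
    (hf : f.IsHomogeneous d) (c : ℝ) (u : Fin n → ℝ) :
    eval (fun i => c * u i) f = c ^ d * eval u f := by
  rw [eval_eq', eval_eq', Finset.mul_sum]
  refine Finset.sum_congr rfl fun s hs => ?_
  have hdeg : d = ∑ i, s i := by
    rw [← Finsupp.degree_eq_sum, Finsupp.degree_apply]
    exact hf.degree_eq_sum_deg_support hs
  simp only [mul_pow, Finset.prod_mul_distrib, Finset.prod_pow_eq_pow_sum, ← hdeg]
  ring

theorem eq_zero_of_dehomSubst_eq_zero {m d : ℕ} {f : MvPolynomial (Fin (m + 1)) ℝ}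
    (hf : f.IsHomogeneous d) (h : dehomSubst m f = 0) : f = 0 := by
  have hplane : ∀ u : Fin (m + 1) → ℝ, ∑ i, u i = 1 → eval u f = 0 := by
    intro u hu
    have h1 : eval (fun i => u (Fin.castSucc i)) (dehomSubst m f) = eval u f := by
      have : ((aeval fun i => u (Fin.castSucc i)) : MvPolynomial (Fin m) ℝ →ₐ[ℝ] ℝ).comp
          (dehomSubst m) = aeval u := by
        ext i
        refine Fin.lastCases ?_ (fun j => ?_) i
        · rw [Fin.sum_univ_castSucc] at hu
          simp [dehomSubst_last, linForm]
          linarith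
        · simp [dehomSubst_castSucc]
      exact DFunLike.congr_fun this f
    rw [← h1, h, map_zero]
  have hmul : linForm (m + 1) * f = 0 := by
    refine funext fun u => ?_
    rw [map_mul, map_zero]
    by_cases hs : ∑ i, u i = 0
    · simp [linForm, hs]
    · have h2 := hplane (fun i => (∑ i, u i)⁻¹ * u i) (by
        rw [← Finset.mul_sum, inv_mul_cancel₀ hs])
      have h3 : eval (fun i => (∑ i, u i)⁻¹ * u i) f = ((∑ i, u i)⁻¹) ^ d * eval u f :=
        eval_mul_of_isHomogeneous hf _ _
      rw [h3] at h2
      have h4 : ((∑ i, u i)⁻¹) ^ d ≠ 0 := pow_ne_zero _ (inv_ne_zero hs)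
      rw [(mul_eq_zero.mp h2).resolve_left h4, mul_zero]
  refine (mul_eq_zero.mp hmul).resolve_left fun h0 => ?_
  have := dehomSubst_linForm m
  rw [h0, map_zero] at this
  exact zero_ne_one this

/-- The dehomogenization isomorphism `ϖ : ℝ[x]_d^hom ≃ ℝ[x̄]_d`, `ϖ(f) = f(x̄, 1 - e^T x̄)`,
with inverse `∑_α g_α x̄^α ↦ ∑_α g_α x̄^α (e^T x)^{d - |α|}`. -/
def dehom (m d : ℕ) :
    homogeneousSubmodule (Fin (m + 1)) ℝ d ≃ₗ[ℝ] restrictTotalDegree (Fin m) ℝ d where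
  toFun f := ⟨dehomSubst m f.1, dehomSubst_mem f.2⟩
  invFun g := ⟨homogenize m d g.1, homogenize_isHomogeneous m d g.1⟩
  map_add' f g := Subtype.ext (map_add (dehomSubst m) f.1 g.1)
  map_smul' c f := Subtype.ext (map_smul (dehomSubst m) c f.1)
  left_inv f := by
    apply Subtype.ext
    rw [← sub_eq_zero]
    refine eq_zero_of_dehomSubst_eq_zero
      ((homogenize_isHomogeneous m d _).sub ((mem_homogeneousSubmodule d f.1).mp f.2)) ?_
    rw [map_sub, dehomSubst_homogenize (dehomSubst_mem f.2), sub_self]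
  right_inv g := Subtype.ext (dehomSubst_homogenize g.2)

/-- The monomial `x̄^α` as an element of `ℝ[x̄]_d`. -/
def monoElt {m d : ℕ} (α : Idx m d) : restrictTotalDegree (Fin m) ℝ d :=
  ⟨monomial α.1 1, by
    rw [mem_restrictTotalDegree]
    exact (totalDegree_monomial_le _ _).trans α.2⟩

/-- The inverse adjoint `ϖ^{-T}` of the dehomogenization map:
`(ϖ^{-T} y)_α = ⟨ϖ^{-1}(x̄^α), y⟩`. See `pair_dehomInvAdj`. -/
def dehomInvAdj (m d : ℕ) (y : Htms (m + 1) d) : Tms m d :=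
  fun α => hpair ((dehom m d).symm (monoElt α)).1 y

/-- The defining property `⟨f, y⟩ = ⟨ϖ(f), ϖ^{-T}(y)⟩` of the inverse adjoint. -/
theorem pair_dehomInvAdj (m d : ℕ) (f : homogeneousSubmodule (Fin (m + 1)) ℝ d)
    (y : Htms (m + 1) d) : pair (dehom m d f).1 (dehomInvAdj m d y) = hpair f.1 y := by
  have hexp : f = ∑ α : Idx m d, coeff α.1 (dehom m d f).1 • (dehom m d).symm (monoElt α) := by
    apply (dehom m d).injective
    simp only [map_sum, map_smul, LinearEquiv.apply_symm_apply]
    apply Subtype.ext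
    conv_lhs => rw [← sum_idx_monomial (dehom m d f).2]
    simp [monoElt, smul_eq_C_mul]
  conv_rhs => rw [hexp]
  simp only [pair, dehomInvAdj, hpair, Submodule.coe_sum, Submodule.coe_smul, coeff_sum,
    coeff_smul, smul_eq_mul, Finset.sum_mul, Finset.mul_sum]
  rw [Finset.sum_comm]
  simp only [mul_assoc]

/-! ### Localizing matrices and the moment relaxations -/

/-- The `k`th order localizing matrix `L_q^{(k)}[z]`. It is labelled by the monomials `x̄^α` with
`deg (q (x̄^α)^2) ≤ 2k`, and its `(α, β)` entry is `⟨q x̄^{α+β}, z⟩`; hence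
`⟨q a², z⟩ = vec(a)ᵀ L_q^{(k)}[z] vec(a)` whenever `deg (q a²) ≤ 2k`. -/
def localizingMatrix {m k : ℕ} (q : MvPolynomial (Fin m) ℝ) (z : Tms m (2 * k)) :
    Matrix {α : Fin m →₀ ℕ // q.totalDegree + 2 * α.degree ≤ 2 * k}
      {α : Fin m →₀ ℕ // q.totalDegree + 2 * α.degree ≤ 2 * k} ℝ :=
  Matrix.of fun α β => pair (q * monomial (α.1 + β.1) 1) z

/-- The `k`th order moment matrix `M_k[z]`. -/
abbrev momentMatrix {m k : ℕ} (z : Tms m (2 * k)) := localizingMatrix (k := k) 1 z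

/-- The cone `𝒮[Δ̄]_{2k}`, for
`Δ̄ = {x̄ : x̄ ≥ 0, 1 - e^T x̄ ≥ 0, 1 - ‖x̄‖² ≥ 0}`. -/
def momentCone (m k : ℕ) : Set (Tms m (2 * k)) :=
  {z | (momentMatrix z).PosSemidef ∧
    (localizingMatrix (1 - linForm m) z).PosSemidef ∧
    (∀ i : Fin m, (localizingMatrix (X i) z).PosSemidef) ∧
    (localizingMatrix (1 - ∑ i : Fin m, X i ^ 2) z).PosSemidef}

/-- The projection `ℱ[Δ̄]_k` of `𝒮[Δ̄]_{2k}` to the tms of degree `d` (for `d ≤ 2k`). -/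
def projCone (m d k : ℕ) : Set (Tms m d) :=
  {y | ∃ z ∈ momentCone m k, ∀ (α : Fin m →₀ ℕ) (h : α.degree ≤ d) (h' : α.degree ≤ 2 * k),
    y ⟨α, h⟩ = z ⟨α, h'⟩}

/-- The `k`th dehomogenized moment relaxation of `CP_{m+1,d}`. -/
def relaxation (m d k : ℕ) : Set (Htms (m + 1) d) :=
  {y | dehomInvAdj m d y ∈ projCone m d k}

/-- The initial order `d_0 = ⌈d/2⌉`. -/
def initialOrder (d : ℕ) : ℕ := ⌈(d : ℝ) / 2⌉₊

end CPMoment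

end

/-!
Let `y` lie in every relaxation and let `w = ϖ^{-T} y`. For each order `k` there is an extension of
`w` in the moment cone of order `k`. The localizing matrix of `1 - ‖x̄‖²` bounds the entries of
degree at most `k` of such an extension by `w_0`, so a cluster point exists: a full multi-sequence
extending `w`, with entries in `[-w_0, w_0]`, whose functional `L` is nonnegative on the quadratic
module of the simplex `x̄ ≥ 0`, `e^T x̄ ≤ 1`
(`exists_smul_state_of_forall_mem_projCone`).

It remains to represent `w` by points of the simplex. The normalized functionals of this kind
(`states`) form a compact convex set, and an extreme one is the evaluation at a point of the simplex
(`exists_eq_monoSeq_of_mem_extremePoints`). Indeed, for `a = (1 ± x_i) / 2` the functional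
`L (a² ·)` is nonnegative on the quadratic module, and so is `L ((1 - a²) ·)`: for `g` a generator,
`φ = L (· g q²)` is nonnegative on squares and bounded along the powers of `a`, and repeated use of
the Cauchy–Schwarz inequality turns this into `φ (a²) ≤ φ 1` (`abs_le_of_bounded_powers`). By
extremality `L (a² p) = L (a²) L (p)`, and as `x_i` is a difference of two such squares, `L` is
multiplicative. By the Krein–Milman theorem, and since the convex hull of a compact set in finite
dimension is compact, the truncation of a state is a convex combination of vectors `[u]_d` with `u`
in the simplex (`truncate_mem_convexHull`). Each `[u]_d` is the image under `ϖ^{-T}` of the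
homogeneous vector `[(u, 1 - e^T u)]_d^hom`, and `ϖ^{-T}` is injective, so `y` is completely
positive.

Conversely, a nonzero nonnegative point is a positive multiple of one with `e^T u = 1`, whose image
under `ϖ^{-T}` is `[ū]_d` and extends to all orders. Positive semidefiniteness of a localizing
matrix is nonnegativity of `⟨q p², z⟩` (`localizingMatrix_posSemidef_iff`), which makes nestedness
immediate. The statement for tensors follows because `φ` is injective and maps `v^{⊗ d}` to
`[v]_d^hom`.
-/

noncomputable section

namespace CPMoment

open MvPolynomial Filter Topology

/-! ### Convex hulls of compact sets -/

/-- In a finite-dimensional space the convex hull of a compact set is compact: by Carathéodory's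
theorem it is the image of a compact set of weights and points whose number is fixed. -/
theorem isCompact_convexHull_of_isCompact {E : Type*} [AddCommGroup E] [Module ℝ E]
    [TopologicalSpace E] [IsTopologicalAddGroup E] [ContinuousSMul ℝ E] [FiniteDimensional ℝ E]
    {s : Set E} (hs : IsCompact s) : IsCompact (convexHull ℝ s) := by
  classical
  rcases s.eq_empty_or_nonempty with rfl | ⟨x₀, hx₀⟩
  · simp
  let N := Module.finrank ℝ E + 1
  let F : (Fin N → ℝ) × (Fin N → E) → E := fun p => ∑ i, p.1 i • p.2 i
  have hF : Continuous F := by fun_prop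
  have hK : IsCompact (stdSimplex ℝ (Fin N) ×ˢ Set.univ.pi fun _ : Fin N => s) :=
    (isCompact_stdSimplex ℝ (Fin N)).prod (isCompact_univ_pi fun _ => hs)
  convert hK.image hF
  apply Set.Subset.antisymm
  · intro x hx
    obtain ⟨ι, _, z, w, hz, hind, hw, hw1, rfl⟩ := eq_pos_convex_span_of_mem_convexHull hx
    have hcard : Fintype.card ι ≤ Fintype.card (Fin N) := by
      refine hind.card_le_finrank_succ.trans ?_
      simpa [N] using Submodule.finrank_le _
    obtain ⟨e⟩ := Function.Embedding.nonempty_of_card_le hcard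
    refine ⟨(Function.extend e w 0, Function.extend e z fun _ => x₀), ⟨⟨fun i => ?_, ?_⟩, ?_⟩, ?_⟩
    · by_cases hi : ∃ a, e a = i
      · obtain ⟨a, rfl⟩ := hi
        simpa [e.injective.extend_apply] using (hw a).le
      · simp [Function.extend_apply' _ _ _ hi]
    · rw [← hw1]
      symm
      refine Fintype.sum_of_injective e e.injective _ _ (fun i hi => ?_) fun a => ?_
      · exact Function.extend_apply' _ _ _ hi
      · simp [e.injective.extend_apply]
    · intro i _
      by_cases hi : ∃ a, e a = i
      · obtain ⟨a, rfl⟩ := hi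
        simpa [e.injective.extend_apply] using hz (Set.mem_range_self a)
      · simpa [Function.extend_apply' _ _ _ hi] using hx₀
    · symm
      refine Fintype.sum_of_injective e e.injective _ _ (fun i hi => ?_) fun a => ?_
      · have : Function.extend e w 0 i = 0 := Function.extend_apply' _ _ _ hi
        simp [this]
      · simp [e.injective.extend_apply]
  · rintro _ ⟨⟨w, z⟩, ⟨hw, hz⟩, rfl⟩
    exact (convex_convexHull ℝ s).sum_mem (fun i _ => hw.1 i) hw.2
      fun i _ => subset_convexHull ℝ s (hz i trivial)

/-! ### Positive functionals with bounded powers -/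

/-- Cauchy–Schwarz inequality against `1` for a functional that is nonnegative on squares. -/
theorem sq_le_of_nonneg_on_squares {A : Type*} [CommRing A] [Algebra ℝ A] (φ : A →ₗ[ℝ] ℝ)
    (hφ : ∀ q, 0 ≤ φ (q * q)) (a : A) : φ a ^ 2 ≤ φ 1 * φ (a * a) := by
  have h := discrim_le_zero (a := φ 1) (b := 2 * φ a) (c := φ (a * a)) fun t => by
    have := hφ (t • (1 : A) + a)
    have e : (t • (1 : A) + a) * (t • (1 : A) + a) = (t * t) • (1 : A) + (2 * t) • a + a * a := by
      simp only [Algebra.smul_def, map_mul, map_ofNat]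
      ring
    rw [e, map_add, map_add, map_smul, map_smul, smul_eq_mul, smul_eq_mul] at this
    linarith
  rw [discrim] at h
  linarith

/-- If a functional is nonnegative on squares and bounded along the powers of `a`, then
`|φ a| ≤ φ 1`. Iterating the Cauchy–Schwarz inequality gives
`(|φ a| / φ 1) ^ (2 ^ n) ≤ C / φ 1` for all `n`. -/
theorem abs_le_of_bounded_powers {A : Type*} [CommRing A] [Algebra ℝ A] (φ : A →ₗ[ℝ] ℝ)
    (hφ : ∀ q, 0 ≤ φ (q * q)) (a : A) (C : ℝ) (hC : ∀ N : ℕ, |φ (a ^ N)| ≤ C) :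
    |φ a| ≤ φ 1 := by
  have h1 : 0 ≤ φ 1 := by simpa using hφ 1
  rcases h1.eq_or_lt with h0 | hpos
  · have := sq_le_of_nonneg_on_squares φ hφ a
    rw [← h0, zero_mul] at this
    have : φ a = 0 := by nlinarith [sq_nonneg (φ a)]
    simp [this, ← h0]
  have key : ∀ n : ℕ, |φ a| ^ (2 ^ n) * φ 1 ≤ φ 1 ^ (2 ^ n) * |φ (a ^ (2 ^ n))| := by
    intro n
    induction n with
    | zero => simp [mul_comm]
    | succ n ih =>
      have hsq := sq_le_of_nonneg_on_squares φ hφ (a ^ (2 ^ n))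
      rw [← pow_add, ← two_mul, ← pow_succ'] at hsq
      have h2 : (|φ a| ^ (2 ^ n) * φ 1) ^ 2 ≤ (φ 1 ^ (2 ^ n) * |φ (a ^ (2 ^ n))|) ^ 2 :=
        pow_le_pow_left₀ (by positivity) ih 2
      rw [mul_pow, mul_pow, sq_abs, ← pow_mul, ← pow_mul, ← pow_succ] at h2
      have h3 : φ 1 ^ (2 ^ (n + 1)) * φ (a ^ (2 ^ n)) ^ 2 ≤
          φ 1 ^ (2 ^ (n + 1)) * (φ 1 * |φ (a ^ (2 ^ (n + 1)))|) := by
        refine mul_le_mul_of_nonneg_left (hsq.trans ?_) (by positivity)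
        exact mul_le_mul_of_nonneg_left (le_abs_self _) h1
      refine le_of_mul_le_mul_right ?_ hpos
      linarith
  by_contra! hlt
  have hr : 1 < |φ a| / φ 1 := (one_lt_div hpos).mpr hlt
  obtain ⟨n, hn⟩ := pow_unbounded_of_one_lt (C / φ 1) hr
  have hle : (|φ a| / φ 1) ^ n ≤ (|φ a| / φ 1) ^ (2 ^ n) :=
    pow_le_pow_right₀ hr.le Nat.lt_two_pow_self.le
  have hk := key n
  have hb : (|φ a| / φ 1) ^ (2 ^ n) ≤ C / φ 1 := by
    rw [div_pow, div_le_div_iff₀ (by positivity) hpos, mul_comm C]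
    exact hk.trans (mul_le_mul_of_nonneg_left (hC _) (by positivity))
  linarith

/-! ### The functional of a multi-sequence -/

/-- The functional `p ↦ ∑_α p_α z_α` on polynomials of a (full) multi-sequence `z`. -/
def riesz {m : ℕ} (z : (Fin m →₀ ℕ) → ℝ) : MvPolynomial (Fin m) ℝ →ₗ[ℝ] ℝ :=
  (basisMonomials (Fin m) ℝ).constr ℝ z

theorem riesz_eq_sum {m : ℕ} (z : (Fin m →₀ ℕ) → ℝ) (p : MvPolynomial (Fin m) ℝ) :
    riesz z p = ∑ α ∈ p.support, coeff α p * z α := by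
  rw [riesz, Module.Basis.constr_apply]
  rfl

theorem riesz_monomial {m : ℕ} (z : (Fin m →₀ ℕ) → ℝ) (α : Fin m →₀ ℕ) :
    riesz z (monomial α 1) = z α := by
  have h : monomial α (1 : ℝ) = basisMonomials (Fin m) ℝ α := by rw [coe_basisMonomials]
  rw [riesz, h, Module.Basis.constr_basis]

theorem riesz_one {m : ℕ} (z : (Fin m →₀ ℕ) → ℝ) : riesz z 1 = z 0 :=
  riesz_monomial z 0

theorem riesz_add {m : ℕ} (z w : (Fin m →₀ ℕ) → ℝ) : riesz (z + w) = riesz z + riesz w :=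
  map_add _ z w

theorem riesz_smul {m : ℕ} (c : ℝ) (z : (Fin m →₀ ℕ) → ℝ) : riesz (c • z) = c • riesz z :=
  map_smul _ c z

theorem riesz_congr {m : ℕ} {z w : (Fin m →₀ ℕ) → ℝ} {p : MvPolynomial (Fin m) ℝ} {t : ℕ}
    (hp : p.totalDegree ≤ t) (h : ∀ α : Fin m →₀ ℕ, α.degree ≤ t → z α = w α) :
    riesz z p = riesz w p := by
  rw [riesz_eq_sum, riesz_eq_sum]
  exact Finset.sum_congr rfl fun α hα => by rw [h α ((le_totalDegree hα).trans hp)]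

theorem continuous_riesz {m : ℕ} (p : MvPolynomial (Fin m) ℝ) :
    Continuous fun z : (Fin m →₀ ℕ) → ℝ => riesz z p := by
  simp only [riesz_eq_sum]
  fun_prop

/-- A functional on polynomials is determined by its values on monomials. -/
theorem eq_riesz {m : ℕ} (φ : MvPolynomial (Fin m) ℝ →ₗ[ℝ] ℝ) :
    riesz (fun α => φ (monomial α 1)) = φ :=
  (basisMonomials (Fin m) ℝ).ext fun α => by simp [riesz_monomial]

theorem riesz_mul_left {m : ℕ} (z : (Fin m →₀ ℕ) → ℝ) (a p : MvPolynomial (Fin m) ℝ) :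
    riesz (fun α => riesz z (a * monomial α 1)) p = riesz z (a * p) :=
  DFunLike.congr_fun (eq_riesz ((riesz z).comp (LinearMap.mulLeft ℝ a))) p

/-- The sequence `(u^α)_α` of all monomials evaluated at `u`. -/
def monoSeq {m : ℕ} (u : Fin m → ℝ) : (Fin m →₀ ℕ) → ℝ := fun α => ∏ i, u i ^ α i

theorem riesz_monoSeq {m : ℕ} (u : Fin m → ℝ) (p : MvPolynomial (Fin m) ℝ) :
    riesz (monoSeq u) p = eval u p := by
  rw [riesz_eq_sum, eval_eq']
  rfl

/-! ### States of the simplex and their extreme points -/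

/-- The polynomials whose nonnegativity describes the simplex `x̄ ≥ 0`, `e^T x̄ ≤ 1`, together
with the constant `1`. -/
def simplexGens (m : ℕ) : Set (MvPolynomial (Fin m) ℝ) := {1, 1 - linForm m} ∪ Set.range X

/-- The simplex `{u : u ≥ 0, e^T u ≤ 1}`. -/
def simplex (m : ℕ) : Set (Fin m → ℝ) := {u | (∀ i, 0 ≤ u i) ∧ ∑ i, u i ≤ 1}

/-- The normalized multi-sequences, with entries in `[-1, 1]`, whose functional is nonnegative on
the quadratic module generated by `simplexGens m`. -/
def states (m : ℕ) : Set ((Fin m →₀ ℕ) → ℝ) :=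
  {z | z 0 = 1 ∧ (∀ α, |z α| ≤ 1) ∧ ∀ g ∈ simplexGens m, ∀ q, 0 ≤ riesz z (g * (q * q))}

theorem isCompact_simplex (m : ℕ) : IsCompact (simplex m) := by
  have hc : IsClosed (simplex m) := by
    refine IsClosed.and ?_ (isClosed_le (by fun_prop) continuous_const)
    simp only [Set.ofPred_forall]
    exact isClosed_iInter fun i => isClosed_le continuous_const (continuous_apply i)
  refine (isCompact_univ_pi fun _ : Fin m => isCompact_Icc (a := (0 : ℝ)) (b := 1))
    |>.of_isClosed_subset hc fun u hu i _ => ⟨hu.1 i, ?_⟩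
  exact (Finset.single_le_sum (fun j _ => hu.1 j) (Finset.mem_univ i)).trans hu.2

theorem convex_states (m : ℕ) : Convex ℝ (states m) := by
  rintro z ⟨hz0, hz1, hz⟩ w ⟨hw0, hw1, hw⟩ a b ha hb hab
  refine ⟨by simp [hz0, hw0, hab], fun α => ?_, fun g hg q => ?_⟩
  · calc |(a • z + b • w) α| ≤ |a * z α| + |b * w α| := abs_add_le _ _
      _ = a * |z α| + b * |w α| := by rw [abs_mul, abs_mul, abs_of_nonneg ha, abs_of_nonneg hb]
      _ ≤ a * 1 + b * 1 := by gcongr <;> simp [hz1, hw1]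
      _ = 1 := by linarith
  · rw [riesz_add, riesz_smul, riesz_smul]
    exact add_nonneg (mul_nonneg ha (hz g hg q)) (mul_nonneg hb (hw g hg q))

theorem isCompact_states (m : ℕ) : IsCompact (states m) := by
  have hc : IsClosed (states m) := by
    refine (isClosed_eq (continuous_apply 0) continuous_const).and (IsClosed.and ?_ ?_)
    · simp only [Set.ofPred_forall]
      exact isClosed_iInter fun α => isClosed_le (continuous_apply α).abs continuous_const
    · simp only [Set.ofPred_forall]
      exact isClosed_iInter fun g => isClosed_iInter fun _ => isClosed_iInter fun q =>
        isClosed_le continuous_const (continuous_riesz _)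
  exact (isCompact_univ_pi fun _ : Fin m →₀ ℕ => isCompact_Icc (a := (-1 : ℝ)) (b := 1))
    |>.of_isClosed_subset hc fun z hz α _ => abs_le.mp (hz.2.1 α)

/-- The polynomial `(1 + s x_i) / 2`. For `s = ±1` its coefficients have absolute sum `1`, and
`x_i` is the difference of the squares of the two. -/
def halfShift {m : ℕ} (i : Fin m) (s : ℝ) : MvPolynomial (Fin m) ℝ := C (1 / 2) * (1 + C s * X i)

theorem abs_riesz_halfShift_pow_le {m : ℕ} {z : (Fin m →₀ ℕ) → ℝ} (hz : ∀ α, |z α| ≤ 1)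
    (i : Fin m) {s : ℝ} (hs : |s| ≤ 1) (N : ℕ) (α : Fin m →₀ ℕ) :
    |riesz z (halfShift i s ^ N * monomial α 1)| ≤ 1 := by
  induction N generalizing α with
  | zero => simpa [riesz_monomial] using hz α
  | succ N ih =>
    have e : halfShift i s ^ (N + 1) * monomial α 1 =
        (1 / 2 : ℝ) • (halfShift i s ^ N * monomial α 1) +
        (s / 2) • (halfShift i s ^ N * monomial (α + Finsupp.single i 1) 1) := by
      have hm : monomial (α + Finsupp.single i 1) (1 : ℝ) = monomial α 1 * X i := by
        rw [X, monomial_mul, one_mul]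
      have hC : (C (s / 2) : MvPolynomial (Fin m) ℝ) = C (1 / 2) * C s := by
        rw [← C_mul]
        congr 1
        ring
      rw [hm, smul_eq_C_mul, smul_eq_C_mul, hC, pow_succ]
      conv_lhs => enter [1, 2]; rw [halfShift]
      ring
    rw [e, map_add, map_smul, map_smul, smul_eq_mul, smul_eq_mul]
    have h1 := ih α
    have h2 := ih (α + Finsupp.single i 1)
    calc _ ≤ |(1 / 2 : ℝ) * riesz z (halfShift i s ^ N * monomial α 1)| +
          |s / 2 * riesz z (halfShift i s ^ N * monomial (α + Finsupp.single i 1) 1)| :=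
          abs_add_le _ _
      _ = 1 / 2 * |riesz z (halfShift i s ^ N * monomial α 1)| + |s| / 2 *
          |riesz z (halfShift i s ^ N * monomial (α + Finsupp.single i 1) 1)| := by
          rw [abs_mul, abs_mul, abs_div s, abs_two, abs_of_pos (one_half_pos (α := ℝ))]
      _ ≤ 1 / 2 * 1 + 1 / 2 * 1 := by gcongr
      _ = 1 := by norm_num

theorem exists_abs_riesz_halfShift_pow_mul_le {m : ℕ} {z : (Fin m →₀ ℕ) → ℝ}
    (hz : ∀ α, |z α| ≤ 1) (i : Fin m) {s : ℝ} (hs : |s| ≤ 1) (p : MvPolynomial (Fin m) ℝ) :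
    ∃ C, ∀ N, |riesz z (halfShift i s ^ N * p)| ≤ C := by
  refine ⟨∑ α ∈ p.support, |coeff α p|, fun N => ?_⟩
  have e : riesz z (halfShift i s ^ N * p) =
      ∑ α ∈ p.support, coeff α p * riesz z (halfShift i s ^ N * monomial α 1) := by
    conv_lhs => rw [p.as_sum, Finset.mul_sum, map_sum]
    refine Finset.sum_congr rfl fun α _ => ?_
    rw [← smul_eq_mul (coeff α p), ← map_smul, ← mul_smul_comm, smul_monomial, smul_eq_mul,
      mul_one]
  rw [e]
  refine (Finset.abs_sum_le_sum_abs _ _).trans (Finset.sum_le_sum fun α _ => ?_)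
  rw [abs_mul]
  exact mul_le_of_le_one_right (abs_nonneg _) (abs_riesz_halfShift_pow_le hz i hs N α)

/-- A functional nonnegative on the quadratic module and bounded on monomials is, after
normalization, a state. -/
theorem inv_smul_mem_states {m : ℕ} {z : (Fin m →₀ ℕ) → ℝ} {C : ℝ} (hC : ∀ α, |z α| ≤ C)
    (hz : ∀ g ∈ simplexGens m, ∀ q, 0 ≤ riesz z (g * (q * q))) (h0 : z 0 ≠ 0) :
    0 < z 0 ∧ (z 0)⁻¹ • z ∈ states m := by
  have hsq : ∀ q, 0 ≤ riesz z (q * q) := fun q => by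
    simpa using hz 1 (by simp [simplexGens]) q
  have hle : ∀ α, |z α| ≤ z 0 := fun α => by
    have := abs_le_of_bounded_powers (riesz z) hsq (monomial α 1) C fun N => by
      rw [monomial_pow, one_pow, riesz_monomial]
      exact hC _
    rwa [riesz_monomial, riesz_one] at this
  have hpos : 0 < z 0 := lt_of_le_of_ne ((abs_nonneg _).trans (hle 0)) h0.symm
  refine ⟨hpos, by simp [h0], fun α => ?_, fun g hg q => ?_⟩
  · rw [Pi.smul_apply, smul_eq_mul, abs_mul, abs_of_pos (inv_pos.mpr hpos), inv_mul_le_one₀ hpos]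
    exact hle α
  · rw [riesz_smul]
    exact mul_nonneg (inv_pos.mpr hpos).le (hz g hg q)

/-- A bounded functional that is nonnegative on squares and vanishes at `1` vanishes. -/
theorem eq_zero_of_apply_zero_eq_zero {m : ℕ} {z : (Fin m →₀ ℕ) → ℝ}
    (hsq : ∀ q, 0 ≤ riesz z (q * q)) (h0 : z 0 = 0) : z = 0 := by
  funext α
  have := sq_le_of_nonneg_on_squares (riesz z) hsq (monomial α 1)
  rw [riesz_one, h0, zero_mul, riesz_monomial] at this
  exact pow_eq_zero_iff two_ne_zero |>.mp (le_antisymm this (sq_nonneg _))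

/-- If `L` is an extreme state and `a = (1 ± x_i) / 2`, then `L (a² p) = L (a²) L (p)`: the
functionals `L (a² ·)` and `L ((1 - a²) ·)` are both nonnegative on the quadratic module, so by
extremality they are proportional to `L`. -/
theorem riesz_sq_mul_of_mem_extremePoints {m : ℕ} {z : (Fin m →₀ ℕ) → ℝ}
    (hz : z ∈ (states m).extremePoints ℝ) (i : Fin m) {s : ℝ} (hs : |s| ≤ 1)
    (p : MvPolynomial (Fin m) ℝ) :
    riesz z (halfShift i s ^ 2 * p) = riesz z (halfShift i s ^ 2) * riesz z p := by
  obtain ⟨⟨hz0, hz1, hzg⟩, hext⟩ := mem_extremePoints.mp hz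
  set a := halfShift i s with ha
  let z₁ : (Fin m →₀ ℕ) → ℝ := fun α => riesz z (a ^ 2 * monomial α 1)
  let z₂ : (Fin m →₀ ℕ) → ℝ := fun α => riesz z ((1 - a ^ 2) * monomial α 1)
  have hr₁ : ∀ p, riesz z₁ p = riesz z (a ^ 2 * p) := riesz_mul_left z (a ^ 2)
  have hr₂ : ∀ p, riesz z₂ p = riesz z ((1 - a ^ 2) * p) := riesz_mul_left z (1 - a ^ 2)
  have hadd : z₁ + z₂ = z := by
    funext α
    simp only [z₁, z₂, Pi.add_apply]
    rw [← map_add, ← add_mul, add_sub_cancel, one_mul, riesz_monomial]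
  have hb₁ : ∀ α, |z₁ α| ≤ 1 := fun α => abs_riesz_halfShift_pow_le hz1 i hs 2 α
  have hb₂ : ∀ α, |z₂ α| ≤ 2 := fun α => by
    have h : z₂ α = z α - z₁ α := by rw [← hadd, Pi.add_apply, add_sub_cancel_left]
    rw [h]
    linarith [abs_sub (z α) (z₁ α), hz1 α, hb₁ α]
  have hp₁ : ∀ g ∈ simplexGens m, ∀ q, 0 ≤ riesz z₁ (g * (q * q)) := fun g hg q => by
    rw [hr₁]
    convert hzg g hg (a * q) using 2
    ring
  have hp₂ : ∀ g ∈ simplexGens m, ∀ q, 0 ≤ riesz z₂ (g * (q * q)) := fun g hg q => by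
    -- `φ` is nonnegative on squares and bounded along the powers of `a²`, so `φ (a²) ≤ φ 1`.
    let φ := (riesz z).comp (LinearMap.mulRight ℝ (g * (q * q)))
    have hφ : ∀ p, φ p = riesz z (p * (g * (q * q))) := fun p => rfl
    obtain ⟨C, hC⟩ := exists_abs_riesz_halfShift_pow_mul_le hz1 i hs (g * (q * q))
    have := abs_le_of_bounded_powers φ (fun r => by
      rw [hφ]
      convert hzg g hg (r * q) using 2
      ring) (a ^ 2) C fun N => by
      rw [hφ, ← pow_mul]
      exact hC _
    rw [hr₂, sub_mul, map_sub, sub_nonneg, ← hφ, ← hφ]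
    exact (le_abs_self _).trans this
  have hsq : ∀ {w : (Fin m →₀ ℕ) → ℝ}, (∀ g ∈ simplexGens m, ∀ q, 0 ≤ riesz w (g * (q * q))) →
      ∀ q, 0 ≤ riesz w (q * q) := fun h q => by simpa using h 1 (by simp [simplexGens]) q
  have hz₁0 : z₁ 0 = riesz z (a ^ 2) := by
    rw [← riesz_one z₁, hr₁, mul_one]
  suffices h : z₁ = z₁ 0 • z by
    rw [← hr₁, ← hz₁0]
    conv_lhs => rw [h, riesz_smul]
    rfl
  by_cases h1 : z₁ 0 = 0
  · rw [h1, zero_smul, eq_zero_of_apply_zero_eq_zero (hsq hp₁) h1]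
  by_cases h2 : z₂ 0 = 0
  · have h3 := eq_zero_of_apply_zero_eq_zero (hsq hp₂) h2
    rw [h3, add_zero] at hadd
    rw [hadd, hz0, one_smul]
  obtain ⟨hpos₁, hmem₁⟩ := inv_smul_mem_states hb₁ hp₁ h1
  obtain ⟨hpos₂, hmem₂⟩ := inv_smul_mem_states hb₂ hp₂ h2
  have hseg := (hext _ hmem₁ _ hmem₂ ⟨z₁ 0, z₂ 0, hpos₁, hpos₂, by
    rw [← hz0, ← hadd, Pi.add_apply], by rw [smul_inv_smul₀ h1, smul_inv_smul₀ h2, hadd]⟩).1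
  rw [← hseg, smul_inv_smul₀ h1]

/-- Extreme states are evaluations at points of the simplex. -/
theorem exists_eq_monoSeq_of_mem_extremePoints {m : ℕ} {z : (Fin m →₀ ℕ) → ℝ}
    (hz : z ∈ (states m).extremePoints ℝ) : ∃ u ∈ simplex m, z = monoSeq u := by
  have hX : ∀ i p, riesz z (X i * p) = riesz z (X i) * riesz z p := by
    intro i p
    have e : (X i : MvPolynomial (Fin m) ℝ) = halfShift i 1 ^ 2 - halfShift i (-1) ^ 2 := by
      have : (C (1 / 2) * C (1 / 2) * 4 : MvPolynomial (Fin m) ℝ) = 1 := by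
        have h4 : (4 : MvPolynomial (Fin m) ℝ) = C 4 := (map_ofNat C 4).symm
        rw [h4, ← C_mul, ← C_mul, ← C_1]
        norm_num
      simp only [halfShift, C_1, C_neg]
      linear_combination (-X i) * this
    rw [e, sub_mul, map_sub, map_sub, sub_mul,
      riesz_sq_mul_of_mem_extremePoints hz i (by simp) p,
      riesz_sq_mul_of_mem_extremePoints hz i (by simp) p]
  obtain ⟨⟨hz0, -, hzg⟩, -⟩ := mem_extremePoints.mp hz
  have heval : ∀ p, riesz z p = eval (fun i => riesz z (X i)) p := by
    intro p
    induction p using MvPolynomial.induction_on with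
    | C c =>
      rw [eval_C, ← mul_one (C c), ← smul_eq_C_mul, map_smul, riesz_one, hz0, smul_eq_mul, mul_one]
    | add p q hp hq => rw [map_add, map_add, hp, hq]
    | mul_X p i hp => rw [mul_comm, hX, map_mul, eval_X, hp]
  refine ⟨fun i => riesz z (X i), ⟨fun i => ?_, ?_⟩, ?_⟩
  · simpa using hzg (X i) (by simp [simplexGens]) 1
  · have := hzg (1 - linForm m) (by simp [simplexGens]) 1
    rw [mul_one, mul_one, map_sub, riesz_one, hz0, linForm, map_sum] at this
    linarith
  · funext α
    rw [← riesz_monomial z, heval, ← riesz_monoSeq, riesz_monomial]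

/-- The vector `[u]_d` of all monomials of degree at most `d`, evaluated at `u`. -/
def tmono (m d : ℕ) (u : Fin m → ℝ) : Tms m d := fun α => monoSeq u α.1

/-- Truncated states are convex combinations of the vectors `[u]_d` with `u` in the simplex. -/
theorem truncate_mem_convexHull {m : ℕ} (d : ℕ) {z : (Fin m →₀ ℕ) → ℝ} (hz : z ∈ states m) :
    (fun α : Idx m d => z α.1) ∈ convexHull ℝ (tmono m d '' simplex m) := by
  have hV : IsCompact (tmono m d '' simplex m) := by
    refine (isCompact_simplex m).image ?_
    unfold tmono monoSeq
    fun_prop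
  let π : ((Fin m →₀ ℕ) → ℝ) →ₗ[ℝ] Tms m d := LinearMap.funLeft ℝ ℝ Subtype.val
  have hπ : Continuous π := continuous_pi fun α => continuous_apply α.1
  change z ∈ π ⁻¹' convexHull ℝ (tmono m d '' simplex m)
  rw [← closure_convexHull_extremePoints (isCompact_states m) (convex_states m)] at hz
  refine closure_minimal (convexHull_min ?_ ?_) ?_ hz
  · intro w hw
    obtain ⟨u, hu, rfl⟩ := exists_eq_monoSeq_of_mem_extremePoints hw
    exact subset_convexHull ℝ _ ⟨u, hu, rfl⟩
  · exact (convex_convexHull ℝ _).linear_preimage π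
  · exact (isCompact_convexHull_of_isCompact hV).isClosed.preimage hπ

/-! ### Localizing matrices as quadratic forms -/

/-- The extension of a truncated multi-sequence by zero. -/
def extendZero {m t : ℕ} (z : Tms m t) : (Fin m →₀ ℕ) → ℝ :=
  fun α => if h : α.degree ≤ t then z ⟨α, h⟩ else 0

theorem extendZero_of_le {m t : ℕ} (z : Tms m t) {α : Fin m →₀ ℕ} (h : α.degree ≤ t) :
    extendZero z α = z ⟨α, h⟩ := dif_pos h

theorem pair_eq_riesz {m t : ℕ} (p : MvPolynomial (Fin m) ℝ) (z : Tms m t) :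
    pair p z = riesz (extendZero z) p := by
  classical
  let S : Finset (Fin m →₀ ℕ) := (Finset.univ : Finset (Idx m t)).map (.subtype _)
  have h1 : pair p z = ∑ α ∈ S, coeff α p * extendZero z α := by
    rw [Finset.sum_map]
    exact Finset.sum_congr rfl fun α _ => by
      rw [Function.Embedding.subtype_apply, extendZero_of_le z α.2]
  have h2 : riesz (extendZero z) p = ∑ α ∈ p.support ∪ S, coeff α p * extendZero z α := by
    rw [riesz_eq_sum]
    refine Finset.sum_subset Finset.subset_union_left fun α _ hα => ?_
    rw [notMem_support_iff.mp hα, zero_mul]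
  rw [h1, h2]
  refine Finset.sum_subset Finset.subset_union_right fun α _ hα => ?_
  have : ¬ α.degree ≤ t := fun h => hα (Finset.mem_map.mpr ⟨⟨α, h⟩, Finset.mem_univ _, rfl⟩)
  rw [extendZero, dif_neg this, mul_zero]

/-- The localizing matrix `L_q^{(k)}[z]` is positive semidefinite if and only if `⟨q p², z⟩ ≥ 0`
for all `p` with `deg q + 2 deg p ≤ 2k`. -/
theorem localizingMatrix_posSemidef_iff {m k : ℕ} (q : MvPolynomial (Fin m) ℝ)
    (z : Tms m (2 * k)) :
    (localizingMatrix q z).PosSemidef ↔ ∀ p : MvPolynomial (Fin m) ℝ,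
      q.totalDegree + 2 * p.totalDegree ≤ 2 * k → 0 ≤ riesz (extendZero z) (q * (p * p)) := by
  classical
  let P : ({α : Fin m →₀ ℕ // q.totalDegree + 2 * α.degree ≤ 2 * k} →₀ ℝ) →
    MvPolynomial (Fin m) ℝ := fun x => x.sum fun α c => c • monomial α.1 1
  have hform : ∀ x, (x.sum fun i xi => x.sum fun j xj => star xi * localizingMatrix q z i j * xj)
      = riesz (extendZero z) (q * (P x * P x)) := by
    intro x
    simp only [P, Finsupp.sum]
    rw [Finset.sum_mul_sum, Finset.mul_sum, map_sum]
    refine Finset.sum_congr rfl fun i _ => ?_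
    rw [Finset.mul_sum, map_sum]
    refine Finset.sum_congr rfl fun j _ => ?_
    rw [smul_mul_smul_comm, mul_smul_comm, map_smul, monomial_mul, one_mul, smul_eq_mul,
      ← pair_eq_riesz, star_trivial]
    simp only [localizingMatrix, Matrix.of_apply]
    ring
  constructor
  · intro h p hp
    have hlab : ∀ α ∈ p.support, q.totalDegree + 2 * α.degree ≤ 2 * k := fun α hα => by
      have : α.degree ≤ p.totalDegree := le_totalDegree hα
      omega
    let x : {α : Fin m →₀ ℕ // q.totalDegree + 2 * α.degree ≤ 2 * k} →₀ ℝ :=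
      Finsupp.onFinset (p.support.subtype _) (fun α => coeff α.1 p) fun α hα => by
        rwa [Finset.mem_subtype, mem_support_iff]
    have hx : P x = p := by
      simp only [P, x]
      refine (Finsupp.onFinset_sum _ fun α => zero_smul ℝ (monomial α.1 (1 : ℝ))).trans ?_
      refine (Finset.sum_subtype_of_mem (fun α => coeff α p • monomial α (1 : ℝ)) hlab).trans ?_
      conv_rhs => rw [p.as_sum]
      exact Finset.sum_congr rfl fun α _ => by rw [smul_monomial, smul_eq_mul, mul_one]
    rw [← hx, ← hform]
    exact h.2 x
  · intro h
    refine ⟨?_, fun x => ?_⟩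
    · ext i j
      simp [localizingMatrix, add_comm]
    · rw [hform]
      rcases eq_or_ne x 0 with rfl | hx
      · simp [P]
      obtain ⟨α₀, -⟩ := Finsupp.support_nonempty_iff.mpr hx
      have hα₀ := α₀.2
      have hdeg : (P x).totalDegree ≤ (2 * k - q.totalDegree) / 2 := by
        refine totalDegree_finsetSum_le fun α _ => ?_
        have h1 := α.2
        have h2 : (monomial α.1 (1 : ℝ)).totalDegree ≤ α.1.degree := totalDegree_monomial_le _ _
        refine (totalDegree_smul_le _ _).trans ?_
        omega
      exact h _ (by omega)

theorem totalDegree_one_sub_linForm_le (m : ℕ) :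
    (1 - linForm m : MvPolynomial (Fin m) ℝ).totalDegree ≤ 1 :=
  (totalDegree_sub _ _).trans
    (max_le (by simp) (linForm_isHomogeneous m).totalDegree_le)

theorem totalDegree_one_sub_sum_sq_le (m : ℕ) :
    (1 - ∑ i : Fin m, X i ^ 2 : MvPolynomial (Fin m) ℝ).totalDegree ≤ 2 :=
  (totalDegree_sub _ _).trans
    (max_le (by simp) (totalDegree_finsetSum_le fun i _ => by simp))

theorem totalDegree_le_of_mem_simplexGens {m : ℕ} {g : MvPolynomial (Fin m) ℝ}
    (hg : g ∈ simplexGens m) : g.totalDegree ≤ 1 := by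
  rcases hg with (rfl | rfl) | ⟨i, rfl⟩
  · simp
  · exact totalDegree_one_sub_linForm_le m
  · simp

theorem riesz_nonneg_of_mem_momentCone {m k : ℕ} {z : Tms m (2 * k)} (hz : z ∈ momentCone m k)
    {g : MvPolynomial (Fin m) ℝ} (hg : g ∈ simplexGens m) {p : MvPolynomial (Fin m) ℝ}
    (hp : g.totalDegree + 2 * p.totalDegree ≤ 2 * k) :
    0 ≤ riesz (extendZero z) (g * (p * p)) := by
  obtain ⟨h1, h2, h3, -⟩ := hz
  rcases hg with (rfl | rfl) | ⟨i, rfl⟩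
  · exact (localizingMatrix_posSemidef_iff _ z).mp h1 p hp
  · exact (localizingMatrix_posSemidef_iff _ z).mp h2 p hp
  · exact (localizingMatrix_posSemidef_iff _ z).mp (h3 i) p hp

/-- In a moment cone the entries of degree at most `k` are bounded by the entry of degree zero: the
localizing matrix of `1 - ‖x̄‖²` gives `z_{2α} ≤ z_0`, and `(1 ± x̄^α)²` gives
`2 |z_α| ≤ z_0 + z_{2α}`. -/
theorem abs_extendZero_le_of_mem_momentCone {m k : ℕ} {z : Tms m (2 * k)}
    (hz : z ∈ momentCone m k) {α : Fin m →₀ ℕ} (hα : α.degree ≤ k) :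
    |extendZero z α| ≤ extendZero z 0 := by
  classical
  have hsq : ∀ p : MvPolynomial (Fin m) ℝ, p.totalDegree ≤ k →
      0 ≤ riesz (extendZero z) (p * p) := fun p hp => by
    simpa using riesz_nonneg_of_mem_momentCone hz (g := 1) (by simp [simplexGens]) (p := p)
      (by rw [totalDegree_one]; omega)
  have hdeg : ∀ (β : Fin m →₀ ℕ) (c : ℝ), (monomial β c).totalDegree ≤ β.degree :=
    fun β c => totalDegree_monomial_le β c
  have hmm : ∀ β : Fin m →₀ ℕ,
      (monomial β 1 * monomial β 1 : MvPolynomial (Fin m) ℝ) = monomial (β + β) 1 := fun β => by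
    rw [monomial_mul, one_mul]
  have hball := (localizingMatrix_posSemidef_iff _ z).mp hz.2.2.2
  have hdouble : ∀ β : Fin m →₀ ℕ, β.degree ≤ k →
      extendZero z (β + β) ≤ extendZero z 0 := by
    intro β hβ
    induction hn : β.degree generalizing β with
    | zero =>
      rw [(Finsupp.degree_eq_zero_iff β).mp hn, add_zero]
    | succ n ih =>
      obtain ⟨i, hi⟩ : ∃ i, β i ≠ 0 := by
        by_contra! h
        have : β = 0 := Finsupp.ext h
        simp [this] at hn
      obtain ⟨γ, rfl⟩ : ∃ γ, β = γ + Finsupp.single i 1 :=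
        ⟨β - Finsupp.single i 1, (Finsupp.sub_add_single_one_cancel hi).symm⟩
      rw [map_add, Finsupp.degree_single] at hn hβ
      refine le_trans ?_ (ih γ (by omega) (by omega))
      have hγ : (monomial γ (1 : ℝ)).totalDegree ≤ γ.degree := hdeg γ 1
      have hb := hball (monomial γ 1) (by
        have := totalDegree_one_sub_sum_sq_le m
        omega)
      have e : ∀ j : Fin m, (X j ^ 2 * (monomial γ 1 * monomial γ 1) : MvPolynomial (Fin m) ℝ) =
          monomial (γ + Finsupp.single j 1) 1 * monomial (γ + Finsupp.single j 1) 1 := fun j => by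
        have : monomial (γ + Finsupp.single j 1) (1 : ℝ) = monomial γ 1 * X j := by
          rw [X, monomial_mul, one_mul]
        rw [this]
        ring
      rw [sub_mul, one_mul, Finset.sum_mul, map_sub, map_sum, hmm, riesz_monomial, sub_nonneg] at hb
      refine le_trans ?_ hb
      have hs := Finset.single_le_sum
        (f := fun j => riesz (extendZero z) (X j ^ 2 * monomial (γ + γ) 1))
        (fun j _ => by
          rw [← hmm, e]
          refine hsq _ ((hdeg _ 1).trans ?_)
          rw [map_add, Finsupp.degree_single]
          omega) (Finset.mem_univ i)
      refine le_trans (le_of_eq ?_) hs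
      rw [← hmm, e, hmm, riesz_monomial]
  have h2 := hdouble α hα
  have hpm : ∀ s : ℝ, s * s = 1 → 0 ≤ extendZero z 0 + 2 * s * extendZero z α +
      extendZero z (α + α) := fun s hs => by
    have := hsq (1 + s • monomial α 1) ((totalDegree_add _ _).trans (max_le (by simp)
      ((totalDegree_smul_le _ _).trans ((hdeg α 1).trans hα))))
    have e : ((1 : MvPolynomial (Fin m) ℝ) + s • monomial α 1) * (1 + s • monomial α 1) =
        1 + (2 * s) • monomial α 1 + (s * s) • (monomial α 1 * monomial α 1) := by
      simp only [smul_eq_C_mul, map_mul, map_ofNat]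
      ring
    rwa [e, hs, one_smul, hmm, map_add, map_add, map_smul, riesz_one, riesz_monomial,
      riesz_monomial, smul_eq_mul] at this
  have hp := hpm 1 (by norm_num)
  have hn := hpm (-1) (by norm_num)
  rw [abs_le]
  constructor <;> linarith

/-! ### The limit of the hierarchy -/

/-- A truncated multi-sequence that lies in all projected moment cones is a nonnegative multiple of
a truncated state. The extensions provided by the cones, cut off at degree `k`, stay in a fixed
compact box, and any cluster point is a state up to scaling. -/
theorem exists_smul_state_of_forall_mem_projCone {m d k₀ : ℕ} {w : Tms m d}
    (hw : ∀ k ≥ k₀, w ∈ projCone m d k) :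
    ∃ c : ℝ, 0 ≤ c ∧ ∃ z ∈ states m, w = c • fun α : Idx m d => z α.1 := by
  classical
  choose! Z hZ hZw using hw
  let c := extendZero w 0
  have hc : ∀ k ≥ k₀, extendZero (Z k) 0 = c := fun k hk => by
    have := hZw k hk 0 (by simp) (by simp)
    rw [extendZero_of_le _ (by simp), ← this]
    exact (extendZero_of_le w (by simp)).symm
  have hc0 : 0 ≤ c := by
    have h := abs_extendZero_le_of_mem_momentCone (hZ k₀ le_rfl) (α := 0) (by simp)
    rw [hc k₀ le_rfl] at h
    exact (abs_nonneg c).trans h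
  let z : ℕ → (Fin m →₀ ℕ) → ℝ := fun k α => if α.degree ≤ k then extendZero (Z k) α else 0
  have hbox : ∀ k ≥ k₀, z k ∈ Set.univ.pi fun _ : Fin m →₀ ℕ => Set.Icc (-c) c := by
    intro k hk α _
    by_cases hα : α.degree ≤ k
    · have := abs_extendZero_le_of_mem_momentCone (hZ k hk) hα
      rw [hc k hk] at this
      simpa [z, hα] using abs_le.mp this
    · simpa [z, hα] using hc0
  let U : Ultrafilter ℕ := Ultrafilter.of atTop
  have hU : (U : Filter ℕ) ≤ atTop := Ultrafilter.of_le atTop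
  have hge : ∀ n, ∀ᶠ k in (U : Filter ℕ), n ≤ k := fun n => hU (eventually_ge_atTop n)
  obtain ⟨y, hy, hlim⟩ := (isCompact_univ_pi fun _ : Fin m →₀ ℕ =>
    isCompact_Icc (a := -c) (b := c)).ultrafilter_le_nhds' (U.map z) ((hge k₀).mono hbox)
  have hlim : Tendsto z U (𝓝 y) := hlim
  have hyb : ∀ α, |y α| ≤ c := fun α => abs_le.mpr (hy α trivial)
  have hpos : ∀ g ∈ simplexGens m, ∀ q, 0 ≤ riesz y (g * (q * q)) := by
    intro g hg q
    refine ge_of_tendsto ((continuous_riesz (g * (q * q))).continuousAt.tendsto.comp hlim) ?_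
    filter_upwards [hge k₀, hge (1 + 2 * q.totalDegree)] with k hk hkq
    have hgd := totalDegree_le_of_mem_simplexGens hg
    have hdeg : (g * (q * q)).totalDegree ≤ k := by
      have h1 := totalDegree_mul g (q * q)
      have h2 := totalDegree_mul q q
      omega
    have : riesz (z k) (g * (q * q)) = riesz (extendZero (Z k)) (g * (q * q)) :=
      riesz_congr hdeg fun α hα => if_pos hα
    rw [Function.comp_apply, this]
    exact riesz_nonneg_of_mem_momentCone (hZ k hk) hg (by omega)
  have hyw : ∀ α : Idx m d, y α.1 = w α := by
    intro α
    refine tendsto_nhds_unique ((continuous_apply α.1).continuousAt.tendsto.comp hlim) ?_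
    refine tendsto_const_nhds.congr' ?_
    filter_upwards [hge k₀, hge d] with k hk hkd
    have h1 : α.1.degree ≤ k := α.2.trans hkd
    have h2 : α.1.degree ≤ 2 * k := by omega
    simp only [Function.comp_apply, z, if_pos h1, extendZero_of_le _ h2]
    exact hZw k hk α.1 α.2 h2
  have hy0 : y 0 = c := (hyw ⟨0, by simp⟩).trans (extendZero_of_le w (by simp)).symm
  rcases eq_or_ne (y 0) 0 with h0 | h0
  · -- Here `w = 0`, and any state will do.
    have hy' : y = 0 := eq_zero_of_apply_zero_eq_zero (fun q => by
      simpa using hpos 1 (by simp [simplexGens]) q) h0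
    refine ⟨0, le_rfl, monoSeq 0, ⟨by simp [monoSeq], fun α => ?_, ?_⟩, ?_⟩
    · rw [monoSeq, Finset.abs_prod]
      refine Finset.prod_le_one (fun _ _ => abs_nonneg _) fun i _ => ?_
      rw [abs_pow]
      exact pow_le_one₀ (abs_nonneg _) (by simp)
    · intro g hg q
      rw [riesz_monoSeq, map_mul, map_mul]
      refine mul_nonneg ?_ (mul_self_nonneg _)
      rcases hg with (rfl | rfl) | ⟨i, rfl⟩ <;> simp [linForm]
    · funext α
      simp [← hyw α, hy']
  · obtain ⟨hp, hst⟩ := inv_smul_mem_states hyb hpos h0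
    refine ⟨y 0, hp.le, _, hst, funext fun α => ?_⟩
    simp [← hyw α, mul_inv_cancel_left₀ h0]

/-! ### Nestedness -/

/-- Truncation maps moment cones into moment cones of lower order. -/
theorem truncate_mem_momentCone {m k l : ℕ} (hkl : k ≤ l) {z : Tms m (2 * l)}
    (hz : z ∈ momentCone m l) :
    (fun α : Idx m (2 * k) => extendZero z α.1) ∈ momentCone m k := by
  have key : ∀ q : MvPolynomial (Fin m) ℝ, (localizingMatrix q z).PosSemidef →
      (localizingMatrix q fun α : Idx m (2 * k) => extendZero z α.1).PosSemidef := by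
    intro q hq
    rw [localizingMatrix_posSemidef_iff] at hq ⊢
    intro p hp
    have hdeg : (q * (p * p)).totalDegree ≤ 2 * k := by
      have h1 := totalDegree_mul q (p * p)
      have h2 := totalDegree_mul p p
      omega
    rw [riesz_congr hdeg fun α hα => extendZero_of_le _ hα]
    exact hq p (by omega)
  exact ⟨key _ hz.1, key _ hz.2.1, fun i => key _ (hz.2.2.1 i), key _ hz.2.2.2⟩

theorem relaxation_antitone {m d k l : ℕ} (hkl : k ≤ l) :
    relaxation m d l ⊆ relaxation m d k := by
  rintro y ⟨z, hz, hzy⟩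
  refine ⟨_, truncate_mem_momentCone hkl hz, fun α h h' => ?_⟩
  have h2 : α.degree ≤ 2 * l := by omega
  rw [hzy α h h2, extendZero_of_le z h2]

/-! ### The inverse adjoint of dehomogenization on monomial vectors -/

theorem hpair_hmono {n d : ℕ} {f : MvPolynomial (Fin n) ℝ} (hf : f.IsHomogeneous d)
    (u : Fin n → ℝ) : hpair f (hmono n d u) = eval u f := by
  classical
  rw [eval_eq', hpair]
  let S : Finset (Fin n →₀ ℕ) := (Finset.univ : Finset (HIdx n d)).map (.subtype _)
  have h1 : ∑ α : HIdx n d, coeff α.1 f * hmono n d u α =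
      ∑ α ∈ S, coeff α f * ∏ i, u i ^ α i := by
    rw [Finset.sum_map]
    rfl
  rw [h1]
  symm
  refine Finset.sum_subset (fun α hα => ?_) fun α _ hα => by
    rw [notMem_support_iff.mp hα, zero_mul]
  have : α.degree = d := by
    rw [Finsupp.degree_apply]
    exact (hf.degree_eq_sum_deg_support hα).symm
  exact Finset.mem_map.mpr ⟨⟨α, this⟩, Finset.mem_univ _, rfl⟩

theorem hpair_add {n d : ℕ} (f : MvPolynomial (Fin n) ℝ) (y y' : Htms n d) :
    hpair f (y + y') = hpair f y + hpair f y' := by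
  simp [hpair, mul_add, Finset.sum_add_distrib]

theorem hpair_smul {n d : ℕ} (f : MvPolynomial (Fin n) ℝ) (c : ℝ) (y : Htms n d) :
    hpair f (c • y) = c * hpair f y := by
  simp [hpair, Finset.mul_sum, mul_left_comm]

/-- `dehomInvAdj` as a linear map. -/
def dehomInvAdjLin (m d : ℕ) : Htms (m + 1) d →ₗ[ℝ] Tms m d where
  toFun := dehomInvAdj m d
  map_add' y y' := funext fun _ => hpair_add _ y y'
  map_smul' c y := funext fun _ => hpair_smul _ c y

theorem dehomInvAdj_injective (m d : ℕ) : Function.Injective (dehomInvAdj m d) := by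
  classical
  intro y y' h
  funext β
  have key : ∀ y : Htms (m + 1) d, hpair (monomial β.1 1) y = y β := by
    intro y
    rw [hpair, Finset.sum_eq_single β]
    · simp
    · intro α _ hα
      rw [coeff_monomial, if_neg fun h => hα (Subtype.ext h.symm), zero_mul]
    · simp
  let f : homogeneousSubmodule (Fin (m + 1)) ℝ d := ⟨monomial β.1 1, isHomogeneous_monomial _ β.2⟩
  rw [← key y, ← key y', ← pair_dehomInvAdj m d f, ← pair_dehomInvAdj m d f, h]

/-- On the hyperplane `e^T u = 1` the inverse adjoint of dehomogenization forgets the last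
coordinate. -/
theorem dehomInvAdj_hmono {m d : ℕ} {u : Fin (m + 1) → ℝ} (hu : ∑ i, u i = 1) :
    dehomInvAdj m d (hmono (m + 1) d u) = tmono m d fun i => u i.castSucc := by
  classical
  funext α
  rw [dehomInvAdj, hpair_hmono ((dehom m d).symm (monoElt α)).2]
  change eval u (homogenize m d (monomial α.1 1)) = _
  have hlin : eval u (linForm (m + 1)) = 1 := by simpa [linForm] using hu
  rw [homogenize, map_sum, Finset.sum_eq_single α]
  · rw [map_mul, map_mul, map_pow, hlin, eval_rename, eval_monomial]
    simp [tmono, monoSeq, Finsupp.prod_fintype]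
  · intro β _ hβ
    rw [coeff_monomial, if_neg fun h => hβ (Subtype.ext h.symm), C_0, zero_mul, map_zero]
  · simp

/-! ### The completely positive cone -/

theorem hmono_smul (n d : ℕ) (c : ℝ) (u : Fin n → ℝ) :
    hmono n d (c • u) = c ^ d • hmono n d u := by
  funext α
  simp only [hmono, Pi.smul_apply, smul_eq_mul, mul_pow, Finset.prod_mul_distrib,
    Finset.prod_pow_eq_pow_sum, ← Finsupp.degree_eq_sum, α.2]

theorem hmono_mem_CPHtms {n : ℕ} (d : ℕ) {u : Fin n → ℝ} (hu : ∀ i, 0 ≤ u i) :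
    hmono n d u ∈ CPHtms n d := ⟨1, fun _ => u, fun _ => hu, by simp⟩

theorem CPHtms_add_mem {n d : ℕ} {y y' : Htms n d} (hy : y ∈ CPHtms n d) (hy' : y' ∈ CPHtms n d) :
    y + y' ∈ CPHtms n d := by
  obtain ⟨r, u, hu, rfl⟩ := hy
  obtain ⟨r', u', hu', rfl⟩ := hy'
  refine ⟨r + r', Fin.append u u', fun s => ?_, by simp [Fin.sum_univ_add]⟩
  refine Fin.addCases (fun s => ?_) (fun s => ?_) s
  · simpa using hu s
  · simpa using hu' s

theorem CPHtms_smul_mem {n d : ℕ} (hd : 0 < d) {c : ℝ} (hc : 0 ≤ c) {y : Htms n d}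
    (hy : y ∈ CPHtms n d) : c • y ∈ CPHtms n d := by
  obtain ⟨r, u, hu, rfl⟩ := hy
  refine ⟨r, fun s => c ^ (d : ℝ)⁻¹ • u s,
    fun s i => mul_nonneg (Real.rpow_nonneg hc _) (hu s i), ?_⟩
  simp only [hmono_smul, Real.rpow_inv_natCast_pow hc hd.ne', Finset.smul_sum]

/-- Convex combinations of vectors `[u]_d` with `u` in the simplex come from the completely
positive cone. -/
theorem convexHull_tmono_subset {m d : ℕ} (hd : 0 < d) :
    convexHull ℝ (tmono m d '' simplex m) ⊆ dehomInvAdj m d '' CPHtms (m + 1) d := by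
  refine convexHull_min ?_ ?_
  · rintro _ ⟨u, hu, rfl⟩
    let v : Fin (m + 1) → ℝ := Fin.snoc (α := fun _ => ℝ) u (1 - ∑ i, u i)
    refine ⟨hmono (m + 1) d v, hmono_mem_CPHtms d fun i => ?_, ?_⟩
    · refine Fin.lastCases ?_ (fun j => ?_) i
      · simpa [v] using hu.2
      · simpa [v] using hu.1 j
    · rw [dehomInvAdj_hmono (by simp [v, Fin.sum_univ_castSucc])]
      simp [v]
  · refine Convex.linear_image (f := dehomInvAdjLin m d) fun y hy y' hy' a b ha hb _ => ?_
    exact CPHtms_add_mem (CPHtms_smul_mem hd ha hy) (CPHtms_smul_mem hd hb hy')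

theorem momentCone_add_mem {m k : ℕ} {z w : Tms m (2 * k)} (hz : z ∈ momentCone m k)
    (hw : w ∈ momentCone m k) : z + w ∈ momentCone m k := by
  have key : ∀ q : MvPolynomial (Fin m) ℝ,
      localizingMatrix q (z + w) = localizingMatrix q z + localizingMatrix q w := fun q => by
    ext i j
    simp [localizingMatrix, pair, mul_add, Finset.sum_add_distrib]
  refine ⟨?_, ?_, fun i => ?_, ?_⟩ <;> simp only [momentMatrix, key]
  · exact hz.1.add hw.1
  · exact hz.2.1.add hw.2.1
  · exact (hz.2.2.1 i).add (hw.2.2.1 i)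
  · exact hz.2.2.2.add hw.2.2.2

theorem smul_tmono_mem_momentCone {m : ℕ} (k : ℕ) {c : ℝ} (hc : 0 ≤ c) {u : Fin m → ℝ}
    (hu : u ∈ simplex m) : c • tmono m (2 * k) u ∈ momentCone m k := by
  have key : ∀ q : MvPolynomial (Fin m) ℝ, 0 ≤ eval u q →
      (localizingMatrix q (c • tmono m (2 * k) u)).PosSemidef := by
    intro q hq
    rw [localizingMatrix_posSemidef_iff]
    intro p hp
    have hdeg : (q * (p * p)).totalDegree ≤ 2 * k := by
      have h1 := totalDegree_mul q (p * p)
      have h2 := totalDegree_mul p p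
      omega
    have : riesz (extendZero (c • tmono m (2 * k) u)) (q * (p * p)) =
        riesz (c • monoSeq u) (q * (p * p)) := riesz_congr hdeg fun α hα => extendZero_of_le _ hα
    rw [this, riesz_smul, LinearMap.smul_apply, riesz_monoSeq, map_mul, map_mul]
    exact mul_nonneg hc (mul_nonneg hq (mul_self_nonneg _))
  have hle : ∀ i, u i ≤ 1 := fun i =>
    (Finset.single_le_sum (fun j _ => hu.1 j) (Finset.mem_univ i)).trans hu.2
  refine ⟨key _ (by simp), key _ ?_, fun i => key _ (by simpa using hu.1 i), key _ ?_⟩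
  · simpa [linForm] using hu.2
  · simp only [map_sub, map_one, map_sum, map_pow, eval_X, sub_nonneg]
    exact (Finset.sum_le_sum fun i _ => pow_le_of_le_one (hu.1 i) (hle i) two_ne_zero).trans hu.2

theorem relaxation_add_mem {m d k : ℕ} {y y' : Htms (m + 1) d} (hy : y ∈ relaxation m d k)
    (hy' : y' ∈ relaxation m d k) : y + y' ∈ relaxation m d k := by
  obtain ⟨z, hz, hzy⟩ := hy
  obtain ⟨z', hz', hzy'⟩ := hy'
  refine ⟨z + z', momentCone_add_mem hz hz', fun α h h' => ?_⟩
  rw [Pi.add_apply, ← hzy α h h', ← hzy' α h h']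
  exact hpair_add _ y y'

theorem smul_hmono_mem_relaxation {m d : ℕ} (k : ℕ) {c : ℝ} (hc : 0 ≤ c) {u : Fin (m + 1) → ℝ}
    (hu : ∀ i, 0 ≤ u i) (hu1 : ∑ i, u i = 1) :
    c • hmono (m + 1) d u ∈ relaxation m d k := by
  have hs : (fun i => u (Fin.castSucc i)) ∈ simplex m := by
    refine ⟨fun i => hu _, ?_⟩
    rw [Fin.sum_univ_castSucc] at hu1
    linarith [hu (Fin.last m)]
  refine ⟨_, smul_tmono_mem_momentCone k hc hs, fun α h h' => ?_⟩
  have : dehomInvAdj m d (c • hmono (m + 1) d u) = c • dehomInvAdj m d (hmono (m + 1) d u) :=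
    map_smul (dehomInvAdjLin m d) c _
  rw [this, dehomInvAdj_hmono hu1]
  rfl

theorem CPHtms_subset_relaxation {m d : ℕ} (hd : 0 < d) (k : ℕ) :
    CPHtms (m + 1) d ⊆ relaxation m d k := by
  rintro _ ⟨r, u, hu, rfl⟩
  have hv : (0 : Fin (m + 1) → ℝ) ≤ Pi.single 0 1 := Pi.single_nonneg.mpr zero_le_one
  refine Finset.sum_induction _ (· ∈ relaxation m d k) (fun _ _ => relaxation_add_mem) ?_ ?_
  · -- The zero sequence is `0 • [u]_d` for any point `u` with `e^T u = 1`.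
    have := smul_hmono_mem_relaxation (m := m) (d := d) k le_rfl
      (u := Pi.single 0 1) hv (by simp)
    rwa [zero_smul] at this
  · intro s _
    have h0 : 0 ≤ ∑ i, u s i := Finset.sum_nonneg fun i _ => hu s i
    rcases h0.eq_or_lt with h | h
    · have hus : u s = (0 : ℝ) • Pi.single 0 1 := by
        rw [zero_smul]
        funext i
        exact (Finset.sum_eq_zero_iff_of_nonneg fun i _ => hu s i).mp h.symm i (Finset.mem_univ i)
      rw [hus, hmono_smul]
      exact smul_hmono_mem_relaxation k (by simp [hd.ne'])
        hv (by simp)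
    · have hus : u s = (∑ i, u s i) • ((∑ i, u s i)⁻¹ • u s) := by rw [smul_inv_smul₀ h.ne']
      rw [hus, hmono_smul]
      refine smul_hmono_mem_relaxation k (pow_nonneg h0 d)
        (fun i => mul_nonneg (inv_nonneg.mpr h0) (hu s i)) ?_
      simp only [Pi.smul_apply, smul_eq_mul, ← Finset.mul_sum]
      exact inv_mul_cancel₀ h.ne'

theorem iInter_relaxation {m d : ℕ} (hd : 0 < d) (k₀ : ℕ) :
    ⋂ k ≥ k₀, relaxation m d k = CPHtms (m + 1) d := by
  refine Set.Subset.antisymm (fun y hy => ?_) (Set.subset_iInter₂ fun k _ =>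
    CPHtms_subset_relaxation hd k)
  rw [Set.mem_iInter₂] at hy
  obtain ⟨c, hc, z, hz, hyz⟩ := exists_smul_state_of_forall_mem_projCone hy
  obtain ⟨y', hy', hyz'⟩ := convexHull_tmono_subset hd (truncate_mem_convexHull d hz)
  have : y = c • y' := dehomInvAdj_injective m d <| by
    rw [hyz, ← hyz']
    exact (map_smul (dehomInvAdjLin m d) c y').symm
  rw [this]
  exact CPHtms_smul_mem hd hc hy'

/-! ### Completely positive tensors -/

theorem phi_injective (n d : ℕ) : Function.Injective (phi n d) := by
  intro A B h
  refine Subtype.ext (funext fun i => ?_)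
  rw [← phi_expo A i, ← phi_expo B i, h]

theorem preimage_phi_CPHtms (n d : ℕ) : phi n d ⁻¹' CPHtms n d = CPTensor n d := by
  ext A
  refine exists_congr fun r => exists_congr fun v => and_congr_right fun _ => ?_
  rw [← (phi_injective n d).eq_iff, map_sum]
  simp only [phi_rankOne]

end CPMoment

end

theorem mainTheorem2 (m d : ℕ) (hd : 0 < d) :
    (∀ k l : ℕ, CPMoment.initialOrder d ≤ k → k ≤ l →
      CPMoment.relaxation m d l ⊆ CPMoment.relaxation m d k) ∧
    (∀ k : ℕ, CPMoment.initialOrder d ≤ k →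
      CPMoment.CPHtms (m + 1) d ⊆ CPMoment.relaxation m d k) ∧
    (⋂ k ≥ CPMoment.initialOrder d, CPMoment.relaxation m d k) = CPMoment.CPHtms (m + 1) d ∧
    (⋂ k ≥ CPMoment.initialOrder d,
      CPMoment.phi (m + 1) d ⁻¹' CPMoment.relaxation m d k) = CPMoment.CPTensor (m + 1) d := by
  refine ⟨fun k l _ hkl => CPMoment.relaxation_antitone hkl,
    fun k _ => CPMoment.CPHtms_subset_relaxation hd k, CPMoment.iInter_relaxation hd _, ?_⟩
  simp only [← Set.preimage_iInter]
  rw [CPMoment.iInter_relaxation hd, CPMoment.preimage_phi_CPHtms]
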